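/- Let $m\ge 1$ and $\mathbb T^m=\mathbb R^m/2\pi\mathbb Z^m$; functions on $\mathbb T^m$ are identified with functions on $\mathbb R^m$ that are $2\pi$-periodic in each variable. For an integrable function $F$ on $\mathbb T^m$ put $\widehat F(k)=\frac1{(2\pi)^m}\int_{[0,2\pi]^m}F(t)e^{-i(k,t)}\,dt$, $k\in\mathbb Z^m$. For $1\le p<2$ let $A_p(\mathbb T^m)$ be the space of integrable (for $p=1$: continuous) functions $F$ on $\mathbb T^m$ with $\|F\|_{A_p(\mathbb T^m)}=\big(\sum_{k\in\mathbb Z^m}|\widehat F(k)|^p\big)^{1/p}<\infty$. For a set $E\subseteq[0,2\pi]^m$, a function $f$ on $E$ belongs to $A_p(\mathbb T^m,E)$ if it is the restriction to $E$ of some $F\in A_p(\mathbb T^m)$, and then $\|f\|_{A_p(\mathbb T^m,E)}=\inf\{\|F\|_{A_p(\mathbb T^m)} : F\in A_p(\mathbb T^m),\ F|_E=f\}$. Let $\omega$ be a continuous nondecreasing function on $[0,+\infty)$ with $\omega(0)=0$, and let $\chi(\delta)=\delta\,\omega(\delta)$, $\delta\ge 0$. For a domain (nonempty connected open set) $V\subseteq\mathbb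 R^m$, a real function $\varphi$ on $V$ belongs to $C^{1,\omega}(V)$ if it is differentiable on $V$ and $\sup\{|\nabla\varphi(t_1)-\nabla\varphi(t_2)| : t_1,t_2\in V,\ |t_1-t_2|\le\delta\}=O(\omega(\delta))$ as $\delta\to+0$. **Theorem 1$'$.** Let $1\le p<2$. Let $V$ be a domain contained in $[0,2\pi]^m$, and let $\varphi\in C^{1,\omega}(V)$ be a real function whose gradient is nondegenerate on $V$, that is, the set $\nabla\varphi(V)$ has positive Lebesgue measure. Then $\chi$ is a bijection of $[0,+\infty)$ onto itself, and, with $\chi^{-1}$ denoting its inverse, there is a constant $c>0$ independent of $\lambda$ such that $$\|e^{i\lambda\varphi}\|_{A_p(\mathbb T^m,V)}\ \ge\ c\,\Big(|\lambda|^{1/p}\,\chi^{-1}\Big(\frac1{|\lambda|}\Big)\Big)^m$$ for all those $\lambda\in\mathbb R$, $|\lambda|\ge 1$, for which $e^{i\lambda\varphi}\in A_p(\mathbb T^m,V)$. -/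

import Mathlib

open MeasureTheory Set Filter Topology
open scoped ENNReal

noncomputable section

/-- The cube `[0, 2π]^m` in `ℝ^m`. -/
def cube (m : ℕ) : Set (EuclideanSpace ℝ (Fin m)) :=
  {t | ∀ j, t j ∈ Set.Icc (0 : ℝ) (2 * Real.pi)}

/-- Functions on the torus `𝕋^m = ℝ^m / 2πℤ^m`, seen as functions on `ℝ^m` that are
`2π`-periodic with respect to each variable. -/
def IsTorusPeriodic {m : ℕ} (F : EuclideanSpace ℝ (Fin m) → ℂ) : Prop :=
  ∀ (t : EuclideanSpace ℝ (Fin m)) (j : Fin m),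
    F (t + EuclideanSpace.single j (2 * Real.pi)) = F t

/-- The Fourier coefficient `F̂(k) = (2π)^{-m} ∫_{[0,2π]^m} F(t) e^{-i(k,t)} dt`. -/
def torusCoeff {m : ℕ} (F : EuclideanSpace ℝ (Fin m) → ℂ) (k : Fin m → ℤ) : ℂ :=
  (1 / (2 * (Real.pi : ℂ)) ^ m) *
    ∫ t in cube m, F t * Complex.exp (-(Complex.I * ((∑ j, (k j : ℝ) * t j : ℝ) : ℂ)))

/-- `F ∈ A_p(𝕋^m)`: `F` is an integrable function on the torus (continuous if `p = 1`) whose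
Fourier coefficients belong to `ℓ^p(ℤ^m)`. -/
structure MemAp {m : ℕ} (p : ℝ) (F : EuclideanSpace ℝ (Fin m) → ℂ) : Prop where
  periodic : IsTorusPeriodic F
  integrable : IntegrableOn F (cube m) volume
  continuous_of_one : p = 1 → Continuous F
  summable : Summable fun k : Fin m → ℤ => ‖torusCoeff F k‖ ^ p

/-- The norm `‖F‖_{A_p(𝕋^m)} = (∑_k |F̂(k)|^p)^{1/p}`. -/
def normAp {m : ℕ} (p : ℝ) (F : EuclideanSpace ℝ (Fin m) → ℂ) : ℝ :=
  (∑' k : Fin m → ℤ, ‖torusCoeff F k‖ ^ p) ^ (1 / p)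

/-- `f ∈ A_p(𝕋^m, E)`: `f` coincides on `E` with some `F ∈ A_p(𝕋^m)`. -/
def MemApLocal {m : ℕ} (p : ℝ) (E : Set (EuclideanSpace ℝ (Fin m)))
    (f : EuclideanSpace ℝ (Fin m) → ℂ) : Prop :=
  ∃ F : EuclideanSpace ℝ (Fin m) → ℂ, MemAp p F ∧ Set.EqOn F f E

/-- The local norm `‖f‖_{A_p(𝕋^m, E)}`: the infimum of `‖F‖_{A_p(𝕋^m)}` over all
`F ∈ A_p(𝕋^m)` that coincide with `f` on `E`. -/
def normApLocal {m : ℕ} (p : ℝ) (E : Set (EuclideanSpace ℝ (Fin m)))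
    (f : EuclideanSpace ℝ (Fin m) → ℂ) : ℝ :=
  sInf {r : ℝ | ∃ F : EuclideanSpace ℝ (Fin m) → ℂ,
    MemAp p F ∧ Set.EqOn F f E ∧ normAp p F = r}

/-- The modulus of continuity `ω(V, g, δ)`, the supremum of `|g(t₁) - g(t₂)|` over
`t₁, t₂ ∈ V` with `|t₁ - t₂| ≤ δ`, as an extended nonnegative number. -/
def modulus {m : ℕ} (V : Set (EuclideanSpace ℝ (Fin m)))
    (g : EuclideanSpace ℝ (Fin m) → EuclideanSpace ℝ (Fin m)) (δ : ℝ) : ℝ≥0∞ :=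
  ⨆ (t₁ ∈ V) (t₂ ∈ V) (_ : dist t₁ t₂ ≤ δ), edist (g t₁) (g t₂)

/-- `φ ∈ C^{1,ω}(V)` for a real function `φ` on an open set `V`: `φ` is differentiable on `V` and
`ω(V, ∇φ, δ) = O(ω(δ))` as `δ → +0`. -/
def MemC1 {m : ℕ} (ω : ℝ → ℝ) (V : Set (EuclideanSpace ℝ (Fin m)))
    (φ : EuclideanSpace ℝ (Fin m) → ℝ) : Prop :=
  DifferentiableOn ℝ φ V ∧
    ∃ C : ℝ, ∀ᶠ δ in 𝓝[>] (0 : ℝ), modulus V (gradient φ) δ ≤ ENNReal.ofReal (C * ω δ)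

/-- The function `χ(δ) = δ ω(δ)`. -/
def chi (ω : ℝ → ℝ) (δ : ℝ) : ℝ := δ * ω δ

/-- The function `χ⁻¹` inverse to `χ` on `[0, ∞)`. -/
def chiInv (ω : ℝ → ℝ) : ℝ → ℝ := Function.invFunOn (chi ω) (Set.Ici 0)

end

/-! Let `F` be any extension of `e^{ilφ}` from `V`, and put `d = χ⁻¹(1/|l|)`, so that `|l| d ω(d) =
1`. At a scale `δ` that is a small multiple of `d`, the phase `lφ` differs from its tangent plane at
`t₀` by at most `1/2`. Integrating `F` against a bump of width `δ` at `t₀`, modulated by the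
frequency `y = l∇φ(t₀)`, therefore gives at least `δ^m / 2` in modulus
(`le_norm_setIntegral_mul_bump`).

On the Fourier side the same integral is bounded by a sum of `|F̂(k)|` weighted by product Cauchy
kernels in `y - k`. Their sum over `k` is bounded uniformly in `δ`, so coefficients much smaller
than `δ^m` contribute a negligible part; the others are controlled by `p`-th powers
(`norm_setIntegral_mul_bump_le`). This gives a lower bound of order `δ^(mp)` for the `|F̂(k)|^p`
smoothed at `y`.

The bound holds for every `y` in `l∇φ(W)`, a set of measure `|l|^m |∇φ(W)|`, while each kernel has
integral `π^m`. Markov's inequality (`ofReal_mul_volume_le_of_le_tsum`) yields `δ^(mp) |l|^m ≲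
‖F‖^p`, and a `p`-th root finishes. -/

/-! ### The Cauchy kernel: its integral and its sums over the integers. -/

/-- The Cauchy kernel `δ / (1 + (δ x)²)`. -/
noncomputable def cauchyKernel (δ x : ℝ) : ℝ := δ * (1 + (δ * x) ^ 2)⁻¹

lemma cauchyKernel_nonneg {δ : ℝ} (hδ : 0 ≤ δ) (x : ℝ) : 0 ≤ cauchyKernel δ x := by
  unfold cauchyKernel; positivity

lemma cauchyKernel_le_one {δ : ℝ} (hδ1 : δ ≤ 1) (x : ℝ) : cauchyKernel δ x ≤ 1 := by
  unfold cauchyKernel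
  have : (1 + (δ * x) ^ 2)⁻¹ ≤ 1 := inv_le_one_of_one_le₀ (by nlinarith [sq_nonneg (δ * x)])
  exact mul_le_one₀ hδ1 (by positivity) this

lemma continuous_cauchyKernel (δ : ℝ) : Continuous (cauchyKernel δ) := by
  unfold cauchyKernel
  refine continuous_const.mul (Continuous.inv₀ (by fun_prop) fun x => ?_)
  positivity

lemma integrable_cauchyKernel {δ : ℝ} (hδ : 0 < δ) : Integrable (cauchyKernel δ) :=
  (integrable_inv_one_add_sq.comp_mul_left' hδ.ne').const_mul δ

lemma integral_cauchyKernel {δ : ℝ} (hδ : 0 < δ) : ∫ x, cauchyKernel δ x = Real.pi := by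
  unfold cauchyKernel
  rw [integral_const_mul, Measure.integral_comp_mul_left (fun x : ℝ => (1 + x ^ 2)⁻¹) δ,
    integral_univ_inv_one_add_sq, smul_eq_mul, abs_of_pos (inv_pos.2 hδ),
    mul_inv_cancel_left₀ hδ.ne']

/-- Since `s² ≤ 2a² + 2` and `δ ≤ 1`, the denominator grows at most threefold over a unit interval.
Sums over `ℤ` thus compare with the integral, uniformly in `δ`. -/
lemma cauchyKernel_le_of_mem_Ioc {δ a s : ℝ} (hδ : 0 < δ) (hδ1 : δ ≤ 1) (hs : s ∈ Ioc a (a + 1)) :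
    cauchyKernel δ a / 3 ≤ cauchyKernel δ s := by
  obtain ⟨h1, h2⟩ := hs
  unfold cauchyKernel
  rw [mul_div_assoc, inv_eq_one_div, inv_eq_one_div, div_div]
  refine mul_le_mul_of_nonneg_left ?_ hδ.le
  refine one_div_le_one_div_of_le (by positivity) ?_
  have h3 : s ^ 2 ≤ 2 * a ^ 2 + 2 := by nlinarith [sq_nonneg (s - a), sq_nonneg (s - 2 * a)]
  have h4 : δ ^ 2 ≤ 1 := by nlinarith
  nlinarith [mul_le_mul_of_nonneg_left h3 (sq_nonneg δ), mul_nonneg (sq_nonneg δ) (sq_nonneg a)]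

lemma hasSum_setIntegral_cauchyKernel {δ : ℝ} (hδ : 0 < δ) (x : ℝ) :
    HasSum (fun k : ℤ => ∫ s in Ioc (x + k) (x + k + 1), cauchyKernel δ s) Real.pi := by
  have h := hasSum_integral_iUnion (μ := volume) (f := cauchyKernel δ)
    (fun k : ℤ => measurableSet_Ioc (a := x + k) (b := x + k + 1))
    (pairwise_disjoint_Ioc_add_intCast x) (integrable_cauchyKernel hδ).integrableOn
  rwa [iUnion_Ioc_add_intCast x, setIntegral_univ, integral_cauchyKernel hδ] at h

lemma cauchyKernel_le_setIntegral {δ : ℝ} (hδ : 0 < δ) (hδ1 : δ ≤ 1) (a : ℝ) :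
    cauchyKernel δ a ≤ 3 * ∫ s in Ioc a (a + 1), cauchyKernel δ s := by
  have h : ∫ _ in Ioc a (a + 1), cauchyKernel δ a / 3 ≤ ∫ s in Ioc a (a + 1), cauchyKernel δ s :=
    setIntegral_mono_on (integrableOn_const (by simp)) (integrable_cauchyKernel hδ).integrableOn
      measurableSet_Ioc fun s hs => cauchyKernel_le_of_mem_Ioc hδ hδ1 hs
  simp at h
  linarith

lemma summable_cauchyKernel {δ : ℝ} (hδ : 0 < δ) (hδ1 : δ ≤ 1) (x : ℝ) :
    Summable fun k : ℤ => cauchyKernel δ (x + k) :=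
  Summable.of_nonneg_of_le (fun _ => cauchyKernel_nonneg hδ.le _)
    (fun _ => cauchyKernel_le_setIntegral hδ hδ1 _)
    ((hasSum_setIntegral_cauchyKernel hδ x).summable.mul_left 3)

lemma tsum_cauchyKernel_le {δ : ℝ} (hδ : 0 < δ) (hδ1 : δ ≤ 1) (x : ℝ) :
    ∑' k : ℤ, cauchyKernel δ (x + k) ≤ 3 * Real.pi := by
  rw [← (hasSum_setIntegral_cauchyKernel hδ x).tsum_eq, ← tsum_mul_left]
  exact (summable_cauchyKernel hδ hδ1 x).tsum_le_tsum
    (fun _ => cauchyKernel_le_setIntegral hδ hδ1 _)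
    ((hasSum_setIntegral_cauchyKernel hδ x).summable.mul_left 3)

lemma summable_cauchyKernel_sub {δ : ℝ} (hδ : 0 < δ) (hδ1 : δ ≤ 1) (x : ℝ) :
    Summable fun k : ℤ => cauchyKernel δ (x - k) := by
  have := (Equiv.neg ℤ).summable_iff.2 (summable_cauchyKernel hδ hδ1 x)
  simpa [Function.comp_def, ← sub_eq_add_neg] using this

lemma tsum_cauchyKernel_sub_le {δ : ℝ} (hδ : 0 < δ) (hδ1 : δ ≤ 1) (x : ℝ) :
    ∑' k : ℤ, cauchyKernel δ (x - k) ≤ 3 * Real.pi := by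
  have := (Equiv.neg ℤ).tsum_eq fun k : ℤ => cauchyKernel δ (x + k)
  simp [← sub_eq_add_neg] at this
  rw [this]
  exact tsum_cauchyKernel_le hδ hδ1 x

/-! ### Products over the coordinates. -/

/-- A product of absolutely convergent series is an absolutely convergent multiple series. -/
lemma summable_norm_and_hasSum_pi_prod {𝕜 ι : Type*} [NormedField 𝕜] [CompleteSpace 𝕜] {m : ℕ}
    (f : Fin m → ι → 𝕜) (hf : ∀ j, Summable fun i => ‖f j i‖) :
    (Summable fun k : Fin m → ι => ‖∏ j, f j (k j)‖) ∧
      HasSum (fun k : Fin m → ι => ∏ j, f j (k j)) (∏ j, ∑' i, f j i) := by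
  induction m with
  | zero => exact ⟨Summable.of_finite, by simp⟩
  | succ m ih =>
    obtain ⟨h1, h2⟩ := ih (fun j => f j.succ) fun j => hf j.succ
    obtain ⟨e, he⟩ : ∃ e : ι × (Fin m → ι) ≃ (Fin (m + 1) → ι), ∀ z, e z = Fin.cons z.1 z.2 :=
      ⟨Fin.consEquiv fun _ => ι, fun _ => rfl⟩
    have key : ∀ z, ∏ j, f j (e z j) = f 0 z.1 * ∏ j : Fin m, f j.succ (z.2 j) := by
      intro z
      simp [he, Fin.prod_univ_succ]
    constructor
    · refine e.summable_iff.1 (((hf 0).mul_norm h1).congr fun z => ?_)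
      rw [Function.comp_apply, key, norm_mul]
    · rw [Fin.prod_univ_succ]
      have hs : Summable fun z : ι × (Fin m → ι) => f 0 z.1 * ∏ j : Fin m, f j.succ (z.2 j) :=
        summable_mul_of_summable_norm (g := fun k : Fin m → ι => ∏ j : Fin m, f j.succ (k j))
          (hf 0) h1
      have h3 := HasSum.mul (g := fun k : Fin m → ι => ∏ j : Fin m, f j.succ (k j))
        (Summable.of_norm (hf 0)).hasSum h2 hs
      refine e.hasSum_iff.1 ?_
      simpa only [Function.comp_def, key] using h3

lemma integrable_prod_coord {m : ℕ} {f : Fin m → ℝ → ℝ} (hf : ∀ j, Integrable (f j)) :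
    Integrable fun t : EuclideanSpace ℝ (Fin m) => ∏ j, f j (t j) :=
  (PiLp.volume_preserving_ofLp (Fin m)).integrable_comp_of_integrable
    (g := fun x : Fin m → ℝ => ∏ j, f j (x j)) (Integrable.fintype_prod hf)

lemma integral_prod_coord {m : ℕ} (f : Fin m → ℝ → ℝ) :
    ∫ t : EuclideanSpace ℝ (Fin m), ∏ j, f j (t j) = ∏ j, ∫ s, f j s := by
  have := (PiLp.volume_preserving_ofLp (Fin m)).integral_comp
    (MeasurableEquiv.toLp 2 (Fin m → ℝ)).symm.measurableEmbedding
    (fun x : Fin m → ℝ => ∏ j, f j (x j))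
  rw [← integral_fintype_prod_volume_eq_prod, ← this]

/-! ### The bump and its Fourier coefficients. -/

/-- The parabolic bump `(1 - ((s - s₀) / δ)²)₊`. -/
noncomputable def bump (s₀ δ s : ℝ) : ℝ := max 0 (1 - ((s - s₀) / δ) ^ 2)

lemma continuous_bump (s₀ δ : ℝ) : Continuous (bump s₀ δ) := by
  unfold bump; fun_prop

lemma bump_nonneg (s₀ δ s : ℝ) : 0 ≤ bump s₀ δ s := le_max_left _ _

lemma bump_le_one (s₀ δ s : ℝ) : bump s₀ δ s ≤ 1 :=
  max_le zero_le_one (by nlinarith [sq_nonneg ((s - s₀) / δ)])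

lemma bump_of_abs_le {s₀ δ s : ℝ} (hδ : 0 < δ) (hs : |s - s₀| ≤ δ) :
    bump s₀ δ s = 1 - ((s - s₀) / δ) ^ 2 := by
  refine max_eq_right ?_
  have : |(s - s₀) / δ| ≤ 1 := by
    rw [abs_div, abs_of_pos hδ]; exact (div_le_one hδ).2 hs
  have := (sq_le_one_iff_abs_le_one _).2 this
  linarith

lemma bump_of_le_abs {s₀ δ s : ℝ} (hδ : 0 < δ) (hs : δ ≤ |s - s₀|) : bump s₀ δ s = 0 := by
  refine max_eq_left ?_
  have : 1 ≤ |(s - s₀) / δ| := by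
    rw [abs_div, abs_of_pos hδ]; exact (one_le_div hδ).2 hs
  have := (one_le_sq_iff_one_le_abs _).2 this
  linarith

lemma integrable_bump (s₀ : ℝ) {δ : ℝ} (hδ : 0 < δ) : Integrable (bump s₀ δ) := by
  refine (continuous_bump s₀ δ).integrable_of_hasCompactSupport ?_
  refine HasCompactSupport.intro (isCompact_closedBall s₀ δ) fun s hs => bump_of_le_abs hδ ?_
  rw [Metric.mem_closedBall, Real.dist_eq, not_le] at hs
  exact hs.le

lemma le_integral_bump (s₀ : ℝ) {δ : ℝ} (hδ : 0 < δ) : δ ≤ ∫ s, bump s₀ δ s := by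
  have h1 : ∫ s in Ioc (s₀ - δ) (s₀ + δ), bump s₀ δ s ≤ ∫ s, bump s₀ δ s :=
    setIntegral_le_integral (integrable_bump s₀ hδ) (Eventually.of_forall (bump_nonneg s₀ δ))
  refine le_trans ?_ h1
  rw [← intervalIntegral.integral_of_le (by linarith)]
  have h2 : ∫ s in (s₀ - δ)..(s₀ + δ), bump s₀ δ s =
      ∫ s in (s₀ - δ)..(s₀ + δ), (1 - ((s - s₀) / δ) ^ 2) := by
    refine intervalIntegral.integral_congr fun s hs => ?_
    rw [uIcc_of_le (by linarith), ← Real.closedBall_eq_Icc, Metric.mem_closedBall,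
      Real.dist_eq] at hs
    exact bump_of_abs_le hδ hs
  rw [h2, intervalIntegral.integral_comp_sub_right (fun s => 1 - (s / δ) ^ 2)]
  have h3 : ∫ s in (s₀ - δ - s₀)..(s₀ + δ - s₀), (1 - (s / δ) ^ 2) = 4 / 3 * δ := by
    simp only [div_pow]
    rw [intervalIntegral.integral_sub (by simp) (Continuous.intervalIntegrable (by fun_prop) _ _),
      intervalIntegral.integral_div, integral_pow]
    simp
    field_simp
    ring
  rw [h3]; linarith

lemma norm_exp_neg_I_mul (x s : ℝ) : ‖Complex.exp (-(Complex.I * x * s))‖ = 1 := by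
  rw [show -(Complex.I * x * s) = ((-(x * s) : ℝ) : ℂ) * Complex.I by push_cast; ring]
  exact Complex.norm_exp_ofReal_mul_I _

/-- The parabola vanishes at both endpoints, so integration by parts leaves no boundary term of
order `1/x`; the decay `x⁻²` makes the coefficients summable. -/
lemma norm_integral_parabola_mul_exp_le {s₀ δ x : ℝ} (hδ : 0 < δ) (hx : 1 ≤ δ * |x|) :
    ‖∫ s in (s₀ - δ)..(s₀ + δ), ((1 - ((s - s₀) / δ) ^ 2 : ℝ) : ℂ) *
      Complex.exp (-(Complex.I * x * s))‖ ≤ 8 / (δ * x ^ 2) := by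
  have hx0 : x ≠ 0 := by rintro rfl; simp at hx; linarith
  have hδ0 : (δ : ℂ) ≠ 0 := by exact_mod_cast hδ.ne'
  set c : ℂ := -(Complex.I * x) with hc
  have hc0 : c ≠ 0 := by simp [hc, hx0]
  have hcn : ‖c‖ = |x| := by simp [hc]
  -- The antiderivative `(P/c - P'/c² + P''/c³) e^{cs}` of `P e^{cs}`, where `P` is the parabola.
  let G : ℝ → ℂ := fun s => ((1 - ((s - s₀ : ℂ) / δ) ^ 2) / c + 2 * ((s - s₀ : ℂ) / δ ^ 2) / c ^ 2
    - 2 / δ ^ 2 / c ^ 3) * Complex.exp (c * s)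
  have hG : ∀ s : ℝ, HasDerivAt G (((1 - ((s - s₀) / δ) ^ 2 : ℝ) : ℂ) *
      Complex.exp (-(Complex.I * x * s))) s := by
    intro s
    have hid : HasDerivAt (fun s : ℝ => (s : ℂ)) 1 s := Complex.ofRealCLM.hasDerivAt
    have hu : HasDerivAt (fun s : ℝ => ((s : ℂ) - s₀) / δ) (1 / δ) s :=
      (hid.sub_const _).div_const _
    have hv : HasDerivAt (fun s : ℝ => ((s : ℂ) - s₀) / δ ^ 2) (1 / δ ^ 2) s :=
      (hid.sub_const _).div_const _
    have hP := ((((hu.pow 2).const_sub 1).div_const c).add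
      ((hv.const_mul 2).div_const (c ^ 2))).sub_const (2 / (δ : ℂ) ^ 2 / c ^ 3)
    have hE : HasDerivAt (fun s : ℝ => Complex.exp (c * s)) (Complex.exp (c * s) * (c * 1)) s :=
      (hid.const_mul c).cexp
    refine HasDerivAt.congr_deriv (f := G) (hP.mul hE) ?_
    rw [show -(Complex.I * x * (s : ℂ)) = c * s by rw [hc]; ring]
    push_cast
    simp
    field_simp
    ring
  rw [intervalIntegral.integral_eq_sub_of_hasDerivAt (fun s _ => hG s)
    (Continuous.intervalIntegrable (by fun_prop) _ _)]
  have hexp : ∀ s : ℝ, ‖Complex.exp (c * s)‖ = 1 := fun s => by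
    rw [hc, neg_mul]; exact norm_exp_neg_I_mul x s
  have e1 : G (s₀ + δ) = (2 / δ / c ^ 2 - 2 / δ ^ 2 / c ^ 3) * Complex.exp (c * (s₀ + δ : ℝ)) := by
    simp only [G]; push_cast; congr 1; field_simp; ring
  have e2 : G (s₀ - δ) = (-(2 / δ / c ^ 2) - 2 / δ ^ 2 / c ^ 3) *
      Complex.exp (c * (s₀ - δ : ℝ)) := by
    simp only [G]; push_cast; congr 1; field_simp; ring
  have hA : ‖(2 / δ / c ^ 2 : ℂ)‖ = 2 / (δ * x ^ 2) := by
    rw [norm_div, norm_div, norm_pow, hcn, sq_abs, div_div]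
    simp [abs_of_pos hδ]
  have hB : ‖(2 / δ ^ 2 / c ^ 3 : ℂ)‖ ≤ 2 / (δ * x ^ 2) := by
    rw [norm_div, norm_div, norm_pow, norm_pow, hcn, div_div]
    simp only [Complex.norm_ofNat, Complex.norm_real, Real.norm_eq_abs, abs_of_pos hδ]
    refine div_le_div_of_nonneg_left (by norm_num) (by positivity) ?_
    rw [← sq_abs x]
    nlinarith [mul_le_mul_of_nonneg_right hx (by positivity : 0 ≤ δ * |x| ^ 2)]
  rw [e1, e2]
  refine (norm_sub_le _ _).trans ?_
  rw [norm_mul, norm_mul, hexp, hexp, mul_one, mul_one]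
  have h1 := norm_sub_le (2 / δ / c ^ 2 : ℂ) (2 / δ ^ 2 / c ^ 3)
  have h2 := norm_sub_le (-(2 / δ / c ^ 2) : ℂ) (2 / δ ^ 2 / c ^ 3)
  rw [norm_neg] at h2
  rw [show 8 / (δ * x ^ 2) = 4 * (2 / (δ * x ^ 2)) by ring]
  linarith

lemma norm_integral_parabola_mul_exp_le_cauchyKernel (s₀ x : ℝ) {δ : ℝ} (hδ : 0 < δ) :
    ‖∫ s in (s₀ - δ)..(s₀ + δ), ((1 - ((s - s₀) / δ) ^ 2 : ℝ) : ℂ) *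
      Complex.exp (-(Complex.I * x * s))‖ ≤ 16 * cauchyKernel δ x := by
  unfold cauchyKernel
  rcases le_total 1 (δ * |x|) with hx | hx
  · refine (norm_integral_parabola_mul_exp_le hδ hx).trans ?_
    have hx0 : x ≠ 0 := by rintro rfl; simp at hx; linarith
    rw [← mul_assoc, ← div_eq_mul_inv, div_le_div_iff₀ (by positivity) (by positivity)]
    have : 1 ≤ (δ * x) ^ 2 := by
      rw [← sq_abs, abs_mul, abs_of_pos hδ]; exact one_le_pow₀ hx
    nlinarith
  · have h := intervalIntegral.norm_integral_le_of_norm_le_const (a := s₀ - δ) (b := s₀ + δ)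
      (f := fun s : ℝ => ((1 - ((s - s₀) / δ) ^ 2 : ℝ) : ℂ) * Complex.exp (-(Complex.I * x * s)))
      (C := 1) (fun s hs => by
        rw [uIoc_of_le (by linarith)] at hs
        have h1 : |s - s₀| ≤ δ := abs_le.2 ⟨by linarith [hs.1], by linarith [hs.2]⟩
        rw [norm_mul, norm_exp_neg_I_mul, mul_one, ← bump_of_abs_le hδ h1, Complex.norm_real,
          Real.norm_eq_abs, abs_of_nonneg (bump_nonneg _ _ _)]
        exact bump_le_one _ _ _)
    refine h.trans ?_
    rw [show s₀ + δ - (s₀ - δ) = 2 * δ by ring, abs_of_pos (by positivity), ← mul_assoc,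
      ← div_eq_mul_inv, one_mul, ← mul_div_assoc, le_div_iff₀ (by positivity)]
    have : (δ * x) ^ 2 ≤ 1 := by
      rw [← sq_abs, abs_mul, abs_of_pos hδ]; exact pow_le_one₀ (by positivity) hx
    nlinarith

/-- The bump is supported in `[0, 2π]`, so its product with an exponential of any real frequency `y`
has a continuous periodic extension. Summable coefficients then give pointwise convergence of the
Fourier series. -/
lemma exists_hasSum_bump_mul_exp {s₀ δ : ℝ} (y : ℝ) (hδ : 0 < δ) (hδ1 : δ ≤ 1) (h0 : 0 ≤ s₀ - δ)
    (h1 : s₀ + δ ≤ 2 * Real.pi) :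
    ∃ c : ℤ → ℂ, (∀ n, ‖c n‖ ≤ 16 * cauchyKernel δ (y - n)) ∧
      ∀ s ∈ Icc 0 (2 * Real.pi), HasSum (fun n : ℤ => c n * Complex.exp (-(Complex.I * n * s)))
        (bump s₀ δ s * Complex.exp (-(Complex.I * y * s))) := by
  have hπ := Real.pi_pos
  have : Fact (0 < 2 * Real.pi) := ⟨Real.two_pi_pos⟩
  set f : ℝ → ℂ := fun s => bump s₀ δ s * Complex.exp (-(Complex.I * y * s)) with hf
  have hfc : Continuous f := by
    have := continuous_bump s₀ δ
    fun_prop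
  have hf0 : f 0 = 0 := by
    simp only [hf]
    rw [bump_of_le_abs hδ (by rw [le_abs]; right; linarith)]; simp
  have hf1 : f (0 + 2 * Real.pi) = 0 := by
    simp only [hf]
    rw [bump_of_le_abs hδ (by rw [le_abs]; left; linarith)]; simp
  let F : C(AddCircle (2 * Real.pi), ℂ) := ⟨AddCircle.liftIco (2 * Real.pi) 0 f,
    AddCircle.liftIco_continuous (hf0.trans hf1.symm) hfc.continuousOn⟩
  have hcoeff : ∀ n : ℤ, ‖fourierCoeff F n‖ ≤ 16 * cauchyKernel δ (y + n) := by
    intro n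
    change ‖fourierCoeff (AddCircle.liftIco (2 * Real.pi) 0 f) n‖ ≤ _
    rw [fourierCoeff_liftIco_eq, fourierCoeffOn_eq_integral]
    have hint : ∫ s in (0 : ℝ)..(0 + 2 * Real.pi),
        (fourier (-n) (s : AddCircle (0 + 2 * Real.pi - 0))) • f s =
        ∫ s in (s₀ - δ)..(s₀ + δ), ((1 - ((s - s₀) / δ) ^ 2 : ℝ) : ℂ) *
          Complex.exp (-(Complex.I * (y + n : ℝ) * s)) := by
      have hpt : ∀ s : ℝ, (fourier (-n) (s : AddCircle (0 + 2 * Real.pi - 0))) • f s =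
          bump s₀ δ s * Complex.exp (-(Complex.I * (y + n : ℝ) * s)) := by
        intro s
        rw [fourier_coe_apply, smul_eq_mul, hf]
        simp only
        rw [mul_left_comm, ← Complex.exp_add]
        congr 2
        push_cast
        have : (Real.pi : ℂ) ≠ 0 := by exact_mod_cast hπ.ne'
        field_simp
        ring
      simp only [hpt]
      have hcont : Continuous fun s : ℝ => (bump s₀ δ s : ℂ) *
          Complex.exp (-(Complex.I * (y + n : ℝ) * s)) := by
        have := continuous_bump s₀ δ
        fun_prop
      rw [← intervalIntegral.integral_add_adjacent_intervals (b := s₀ - δ)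
        (hcont.intervalIntegrable _ _) (hcont.intervalIntegrable _ _),
        ← intervalIntegral.integral_add_adjacent_intervals (a := s₀ - δ) (b := s₀ + δ)
        (hcont.intervalIntegrable _ _) (hcont.intervalIntegrable _ _)]
      have z1 : ∫ s in (0 : ℝ)..(s₀ - δ), (bump s₀ δ s : ℂ) *
          Complex.exp (-(Complex.I * (y + n : ℝ) * s)) = 0 := by
        refine (intervalIntegral.integral_congr (g := fun _ => 0) fun s hs => ?_).trans (by simp)
        rw [uIcc_of_le h0] at hs
        simp only
        rw [bump_of_le_abs hδ (by rw [le_abs]; right; linarith [hs.2])]; simp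
      have z2 : ∫ s in (s₀ + δ)..(0 + 2 * Real.pi), (bump s₀ δ s : ℂ) *
          Complex.exp (-(Complex.I * (y + n : ℝ) * s)) = 0 := by
        refine (intervalIntegral.integral_congr (g := fun _ => 0) fun s hs => ?_).trans (by simp)
        rw [uIcc_of_le (by linarith)] at hs
        simp only
        rw [bump_of_le_abs hδ (by rw [le_abs]; left; linarith [hs.1])]; simp
      rw [z1, z2, zero_add, add_zero]
      refine intervalIntegral.integral_congr fun s hs => ?_
      rw [uIcc_of_le (by linarith)] at hs
      rw [bump_of_abs_le hδ (abs_le.2 ⟨by linarith [hs.1], by linarith [hs.2]⟩)]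
    rw [hint, norm_smul]
    have h2 := norm_integral_parabola_mul_exp_le_cauchyKernel s₀ (y + n) hδ
    have h3 : ‖1 / (0 + 2 * Real.pi - 0)‖ ≤ 1 := by
      rw [zero_add, sub_zero, Real.norm_eq_abs, abs_of_pos (by positivity)]
      refine div_le_one_of_le₀ ?_ (by positivity)
      linarith [Real.pi_gt_three]
    exact (mul_le_of_le_one_left (norm_nonneg _) h3).trans h2
  have hsum : Summable (fourierCoeff F) :=
    Summable.of_norm_bounded ((summable_cauchyKernel hδ hδ1 y).mul_left 16) hcoeff
  -- The index is reversed so that the series runs over `e^{-ins}`, the exponentials defining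
  -- `torusCoeff`.
  refine ⟨fun n => fourierCoeff F (-n), fun n => ?_, fun s hs => ?_⟩
  · have := hcoeff (-n)
    push_cast at this
    rwa [← sub_eq_add_neg] at this
  · have hval : F (s : AddCircle (2 * Real.pi)) = f s := by
      change AddCircle.liftIco (2 * Real.pi) 0 f s = f s
      rcases hs.2.lt_or_eq with h | h
      · exact AddCircle.liftIco_coe_apply ⟨hs.1, by simpa using h⟩
      · have e : ((s : ℝ) : AddCircle (2 * Real.pi)) = ((0 : ℝ) : AddCircle (2 * Real.pi)) := by
          rw [h]; simp
        rw [e, AddCircle.liftIco_coe_apply ⟨le_rfl, by simpa using Real.two_pi_pos⟩, hf0, h]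
        rw [zero_add] at hf1
        exact hf1.symm
    have h2 := has_pointwise_sum_fourier_series_of_summable hsum (s : AddCircle (2 * Real.pi))
    rw [hval, ← (Equiv.neg ℤ).hasSum_iff] at h2
    convert h2 using 2 with n
    simp only [Function.comp_apply, Equiv.neg_apply, smul_eq_mul]
    rw [fourier_coe_apply]
    congr 2
    push_cast
    have : (Real.pi : ℂ) ≠ 0 := by exact_mod_cast hπ.ne'
    field_simp

/-! ### Upper bound for the test integral by the Fourier coefficients. -/

/-- A threshold at `τ` passes from first powers to `p`-th powers, as a substitute for Hölder's
inequality. -/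
lemma le_add_rpow_mul_rpow {a τ p : ℝ} (ha : 0 ≤ a) (hτ : 0 < τ) (hp : 1 ≤ p) :
    a ≤ τ + τ ^ (1 - p) * a ^ p := by
  rcases le_total a τ with h | h
  · have : 0 ≤ τ ^ (1 - p) * a ^ p := by positivity
    linarith
  · have ha0 : 0 < a := hτ.trans_le h
    have h1 : 1 ≤ τ ^ (1 - p) * a ^ (p - 1) := by
      rw [show 1 - p = -(p - 1) by ring, Real.rpow_neg hτ.le, inv_mul_eq_div,
        one_le_div (by positivity)]
      exact Real.rpow_le_rpow hτ.le h (by linarith)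
    have h2 : a ^ p = a ^ (p - 1) * a := by
      rw [← Real.rpow_add_one ha0.ne']; ring_nf
    rw [h2, ← mul_assoc]
    nlinarith

lemma measurableSet_cube (m : ℕ) : MeasurableSet (cube m) := by
  have : cube m = ⋂ j, {t : EuclideanSpace ℝ (Fin m) | t j ∈ Icc (0 : ℝ) (2 * Real.pi)} := by
    ext; simp [cube]
  rw [this]
  refine MeasurableSet.iInter fun j => ?_
  exact (by fun_prop : Measurable fun t : EuclideanSpace ℝ (Fin m) => t j) measurableSet_Icc

lemma norm_setIntegral_mul_exp {m : ℕ} (F : EuclideanSpace ℝ (Fin m) → ℂ) (k : Fin m → ℤ) :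
    ‖∫ t in cube m, F t * Complex.exp (-(Complex.I * ((∑ j, (k j : ℝ) * t j : ℝ) : ℂ)))‖ =
      (2 * Real.pi) ^ m * ‖torusCoeff F k‖ := by
  unfold torusCoeff
  have hπ := Real.pi_pos
  rw [norm_mul, ← mul_assoc]
  simp [abs_of_pos hπ]

lemma prod_mul_exp {m : ℕ} (c : Fin m → ℂ) (k : Fin m → ℝ) (t : EuclideanSpace ℝ (Fin m)) :
    ∏ j, c j * Complex.exp (-(Complex.I * k j * t j)) =
      (∏ j, c j) * Complex.exp (-(Complex.I * ((∑ j, k j * t j : ℝ) : ℂ))) := by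
  rw [Finset.prod_mul_distrib, ← Complex.exp_sum, Finset.sum_neg_distrib]
  push_cast
  rw [Finset.mul_sum]
  simp only [mul_assoc]

/-- Testing `F` against a modulated bump is controlled by the Fourier coefficients of `F`. -/
lemma norm_setIntegral_mul_bump_le {m : ℕ} {p δ τ : ℝ} (hp : 1 ≤ p)
    {F : EuclideanSpace ℝ (Fin m) → ℂ} (hF : IntegrableOn F (cube m))
    (hs : Summable fun k : Fin m → ℤ => ‖torusCoeff F k‖ ^ p)
    (t₀ y : Fin m → ℝ) (hδ : 0 < δ) (hδ1 : δ ≤ 1) (hτ : 0 < τ)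
    (h0 : ∀ j, 0 ≤ t₀ j - δ) (h1 : ∀ j, t₀ j + δ ≤ 2 * Real.pi) :
    ‖∫ t in cube m, F t * ∏ j, (bump (t₀ j) δ (t j) * Complex.exp (-(Complex.I * y j * t j)))‖ ≤
      (2 * Real.pi * 16) ^ m * (τ * (3 * Real.pi) ^ m + τ ^ (1 - p) *
        ∑' k : Fin m → ℤ, ‖torusCoeff F k‖ ^ p * ∏ j, cauchyKernel δ (y j - k j)) := by
  choose c hc hsum using fun j => exists_hasSum_bump_mul_exp (y j) hδ hδ1 (h0 j) (h1 j)
  have hB0 : ∀ k : Fin m → ℤ, 0 ≤ ∏ j, cauchyKernel δ (y j - k j) := fun k =>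
    Finset.prod_nonneg fun j _ => cauchyKernel_nonneg hδ.le _
  have hB1 : ∀ k : Fin m → ℤ, ∏ j, cauchyKernel δ (y j - k j) ≤ 1 := fun k =>
    Finset.prod_le_one (fun j _ => cauchyKernel_nonneg hδ.le _)
      fun j _ => cauchyKernel_le_one hδ1 _
  obtain ⟨hBs, hBt⟩ := summable_norm_and_hasSum_pi_prod
    (fun (j : Fin m) (n : ℤ) => cauchyKernel δ (y j - n))
    (fun j => (summable_cauchyKernel_sub hδ hδ1 (y j)).norm)
  have hBt' : ∏ j, ∑' n : ℤ, cauchyKernel δ (y j - n) ≤ (3 * Real.pi) ^ m := by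
    refine (Finset.prod_le_prod (fun j _ => tsum_nonneg fun n => cauchyKernel_nonneg hδ.le _)
      fun j _ => tsum_cauchyKernel_sub_le hδ hδ1 (y j)).trans ?_
    simp
  have hS2 : Summable fun k : Fin m → ℤ =>
      ‖torusCoeff F k‖ ^ p * ∏ j, cauchyKernel δ (y j - k j) :=
    Summable.of_nonneg_of_le (fun k => mul_nonneg (by positivity) (hB0 k))
      (fun k => mul_le_of_le_one_right (by positivity) (hB1 k)) hs
  have hcB : ∀ k : Fin m → ℤ, ‖∏ j, c j (k j)‖ ≤ 16 ^ m * ∏ j, cauchyKernel δ (y j - k j) := by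
    intro k
    rw [norm_prod]
    refine (Finset.prod_le_prod (fun j _ => norm_nonneg _) fun j _ => hc j (k j)).trans ?_
    simp [Finset.prod_mul_distrib]
  have hexp : ∀ (k : Fin m → ℤ) (t : EuclideanSpace ℝ (Fin m)),
      ‖Complex.exp (-(Complex.I * ((∑ j, (k j : ℝ) * t j : ℝ) : ℂ)))‖ = 1 := fun k t => by
    simpa using norm_exp_neg_I_mul 1 (∑ j, (k j : ℝ) * t j)
  have hFk : ∀ k : Fin m → ℤ, IntegrableOn (fun t : EuclideanSpace ℝ (Fin m) =>
      F t * Complex.exp (-(Complex.I * ((∑ j, (k j : ℝ) * t j : ℝ) : ℂ)))) (cube m) := by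
    intro k
    refine Integrable.mul_bdd (c := 1) hF
      (Continuous.aestronglyMeasurable (by fun_prop)) ?_
    exact Eventually.of_forall fun t => (hexp k t).le
  have hcs : Summable fun k : Fin m → ℤ => ‖∏ j, c j (k j)‖ := by
    refine Summable.of_nonneg_of_le (fun _ => norm_nonneg _) hcB ?_
    exact (hBt.summable).mul_left _
  have hmain := hasSum_integral_of_summable_integral_norm (μ := volume.restrict (cube m))
    (F := fun (k : Fin m → ℤ) (t : EuclideanSpace ℝ (Fin m)) => (∏ j, c j (k j)) *
      (F t * Complex.exp (-(Complex.I * ((∑ j, (k j : ℝ) * t j : ℝ) : ℂ)))))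
    (fun k => (hFk k).const_mul _) (by
      simp only [norm_mul, hexp, mul_one, integral_const_mul]
      exact hcs.mul_right _)
  have hpt : ∀ t ∈ cube m, ∑' k : Fin m → ℤ, (∏ j, c j (k j)) *
      (F t * Complex.exp (-(Complex.I * ((∑ j, (k j : ℝ) * t j : ℝ) : ℂ)))) =
      F t * ∏ j, (bump (t₀ j) δ (t j) * Complex.exp (-(Complex.I * y j * t j))) := by
    intro t ht
    have h2 := (summable_norm_and_hasSum_pi_prod
      (fun (j : Fin m) (n : ℤ) => c j n * Complex.exp (-(Complex.I * n * t j)))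
      (fun j => (hsum j (t j) (ht j)).summable.norm)).2
    have h3 : ∀ j, ∑' n : ℤ, c j n * Complex.exp (-(Complex.I * n * t j)) =
      bump (t₀ j) δ (t j) * Complex.exp (-(Complex.I * y j * t j)) := fun j =>
      (hsum j (t j) (ht j)).tsum_eq
    simp only [h3] at h2
    rw [← h2.tsum_eq, ← tsum_mul_left]
    refine tsum_congr fun k => ?_
    have := prod_mul_exp (fun j => c j (k j)) (fun j => (k j : ℝ)) t
    simp only [Complex.ofReal_intCast] at this
    rw [this]
    ring
  rw [setIntegral_congr_fun (measurableSet_cube m) hpt] at hmain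
  rw [← hmain.tsum_eq]
  refine tsum_of_norm_bounded (g := fun k : Fin m → ℤ => (2 * Real.pi * 16) ^ m *
    (τ * (∏ j, cauchyKernel δ (y j - k j)) + τ ^ (1 - p) *
      (‖torusCoeff F k‖ ^ p * ∏ j, cauchyKernel δ (y j - k j))))
    (((hBt.mul_left τ).add (hS2.hasSum.mul_left (τ ^ (1 - p)))).mul_left _) (fun k => ?_) |>.trans ?_
  · rw [integral_const_mul, norm_mul, norm_setIntegral_mul_exp, mul_pow (2 * Real.pi) 16]
    have h4 := le_add_rpow_mul_rpow (norm_nonneg (torusCoeff F k)) hτ hp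
    calc _ ≤ (16 ^ m * ∏ j, cauchyKernel δ (y j - k j)) * ((2 * Real.pi) ^ m *
          (τ + τ ^ (1 - p) * ‖torusCoeff F k‖ ^ p)) := by
          have := Real.pi_pos
          gcongr
          · exact mul_nonneg (by positivity) (hB0 k)
          · exact hcB k
      _ = _ := by ring
  · have := Real.pi_pos
    gcongr

/-! ### Lower bound for the test integral. -/

/-- A modulated bump detects an exponential whose phase is nearly affine on the support. -/
lemma le_norm_setIntegral_mul_bump {m : ℕ} {δ l : ℝ} {F : EuclideanSpace ℝ (Fin m) → ℂ}
    (hF : IntegrableOn F (cube m)) (φ : EuclideanSpace ℝ (Fin m) → ℝ)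
    (t₀ ξ : EuclideanSpace ℝ (Fin m)) (hδ : 0 < δ)
    (hcube : ∀ t : EuclideanSpace ℝ (Fin m), (∀ j, |t j - t₀ j| < δ) → t ∈ cube m)
    (hFφ : ∀ t : EuclideanSpace ℝ (Fin m), (∀ j, |t j - t₀ j| < δ) →
      F t = Complex.exp (Complex.I * l * φ t))
    (herr : ∀ t : EuclideanSpace ℝ (Fin m), (∀ j, |t j - t₀ j| < δ) →
      |l * (φ t - φ t₀ - inner ℝ ξ (t - t₀))| ≤ 1 / 2) :
    δ ^ m / 2 ≤ ‖∫ t in cube m, F t * ∏ j, (bump (t₀ j) δ (t j) *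
      Complex.exp (-(Complex.I * (l * ξ j : ℝ) * t j)))‖ := by
  set P : EuclideanSpace ℝ (Fin m) → ℝ := fun t => ∏ j, bump (t₀ j) δ (t j) with hP
  have hP0 : ∀ t, 0 ≤ P t := fun t => Finset.prod_nonneg fun j _ => bump_nonneg _ _ _
  have hP1 : ∀ t, P t ≤ 1 := fun t =>
    Finset.prod_le_one (fun j _ => bump_nonneg _ _ _) fun j _ => bump_le_one _ _ _
  have hPz : ∀ t : EuclideanSpace ℝ (Fin m), (¬ ∀ j, |t j - t₀ j| < δ) → P t = 0 := by
    intro t ht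
    push Not at ht
    obtain ⟨j, hj⟩ := ht
    exact Finset.prod_eq_zero (Finset.mem_univ j) (bump_of_le_abs hδ hj)
  have hPi : Integrable P := integrable_prod_coord fun j => integrable_bump (t₀ j) hδ
  have hPc : Continuous P := continuous_finsetProd _ fun j _ =>
    (continuous_bump _ _).comp (by fun_prop)
  have hPint : δ ^ m ≤ ∫ t in cube m, P t := by
    rw [setIntegral_eq_integral_of_forall_compl_eq_zero fun t ht =>
      hPz t fun h => ht (hcube t h), hP, integral_prod_coord fun j => bump (t₀ j) δ]
    refine le_trans ?_ (Finset.prod_le_prod (f := fun _ => δ) (fun _ _ => hδ.le)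
      fun j _ => le_integral_bump (t₀ j) hδ)
    simp
  -- A unimodular constant cancelling the constant term of the affine phase, so that only the
  -- deviation from the tangent plane survives.
  set u : ℂ := Complex.exp (-(Complex.I * (l * (φ t₀ - inner ℝ ξ t₀) : ℝ))) with hu
  have hun : ‖u‖ = 1 := by rw [hu]; simpa using norm_exp_neg_I_mul 1 (l * (φ t₀ - inner ℝ ξ t₀))
  have hG : ∀ t : EuclideanSpace ℝ (Fin m), ∏ j, ((bump (t₀ j) δ (t j) : ℂ) *
      Complex.exp (-(Complex.I * (l * ξ j : ℝ) * t j))) =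
      P t * Complex.exp (-(Complex.I * (l * inner ℝ ξ t : ℝ))) := by
    intro t
    rw [prod_mul_exp (fun j => (bump (t₀ j) δ (t j) : ℂ)) (fun j => l * ξ j), hP]
    push_cast
    congr 4
    rw [PiLp.inner_apply]
    push_cast
    rw [Finset.mul_sum]
    simp [mul_assoc, mul_comm]
  simp only [hG]
  have hint : IntegrableOn (fun t : EuclideanSpace ℝ (Fin m) => u * (F t *
      (P t * Complex.exp (-(Complex.I * (l * inner ℝ ξ t : ℝ)))))) (cube m) := by
    refine Integrable.const_mul (Integrable.mul_bdd (c := 1) hF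
      (Continuous.aestronglyMeasurable (by fun_prop)) (Eventually.of_forall fun t => ?_)) u
    have := norm_exp_neg_I_mul 1 (l * inner ℝ ξ t)
    rw [Complex.ofReal_one, mul_one] at this
    rw [norm_mul, this, mul_one, Complex.norm_real, Real.norm_eq_abs, abs_of_nonneg (hP0 t)]
    exact hP1 t
  -- On the support the integrand is `P e^{ie}` with `|e| ≤ 1/2`, and `cos e ≥ 1 - e²/2 ≥ 1/2`.
  have hre : ∀ t, P t / 2 ≤ (u * (F t *
      (P t * Complex.exp (-(Complex.I * (l * inner ℝ ξ t : ℝ)))))).re := by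
    intro t
    by_cases ht : ∀ j, |t j - t₀ j| < δ
    · set e := l * (φ t - φ t₀ - inner ℝ ξ (t - t₀)) with he
      have : u * (F t * (P t * Complex.exp (-(Complex.I * (l * inner ℝ ξ t : ℝ))))) =
          P t * Complex.exp (e * Complex.I) := by
        rw [hFφ t ht, hu, mul_left_comm _ (P t : ℂ), mul_left_comm _ (P t : ℂ),
          ← Complex.exp_add, ← Complex.exp_add, he, inner_sub_right]
        congr 2
        push_cast
        ring
      rw [this, Complex.re_ofReal_mul, Complex.exp_ofReal_mul_I_re]
      have h1 := Real.one_sub_sq_div_two_le_cos (x := e)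
      have h2 : e ^ 2 ≤ 1 := (sq_le_one_iff_abs_le_one _).2 ((herr t ht).trans (by norm_num))
      nlinarith [hP0 t]
    · simp [hPz t ht]
  calc δ ^ m / 2 ≤ ∫ t in cube m, P t / 2 := by rw [integral_div]; linarith
    _ ≤ ∫ t in cube m, (u * (F t *
      (P t * Complex.exp (-(Complex.I * (l * inner ℝ ξ t : ℝ)))))).re :=
        integral_mono (hPi.integrableOn.div_const 2) hint.re hre
    _ = (∫ t in cube m, u * (F t *
      (P t * Complex.exp (-(Complex.I * (l * inner ℝ ξ t : ℝ)))))).re := integral_re hint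
    _ ≤ _ := by
      refine (Complex.re_le_norm _).trans ?_
      rw [integral_const_mul, norm_mul, hun, one_mul]

/-! ### Averaging over frequencies. -/

/-- Markov's inequality for a nonnegative combination of translated product Cauchy kernels. -/
lemma ofReal_mul_volume_le_of_le_tsum {m : ℕ} {δ A : ℝ} (hδ : 0 < δ) (hδ1 : δ ≤ 1)
    {a : (Fin m → ℤ) → ℝ} (ha : ∀ k, 0 ≤ a k) (hs : Summable a)
    {S : Set (EuclideanSpace ℝ (Fin m))}
    (hS : ∀ y ∈ S, A ≤ ∑' k, a k * ∏ j, cauchyKernel δ (y j - k j)) :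
    ENNReal.ofReal A * volume S ≤ ENNReal.ofReal (Real.pi ^ m * ∑' k, a k) := by
  have hB0 : ∀ (k : Fin m → ℤ) (y : EuclideanSpace ℝ (Fin m)),
      0 ≤ ∏ j, cauchyKernel δ (y j - k j) := fun k y =>
    Finset.prod_nonneg fun j _ => cauchyKernel_nonneg hδ.le _
  have hB1 : ∀ (k : Fin m → ℤ) (y : EuclideanSpace ℝ (Fin m)),
      ∏ j, cauchyKernel δ (y j - k j) ≤ 1 := fun k y =>
    Finset.prod_le_one (fun j _ => cauchyKernel_nonneg hδ.le _)
      fun j _ => cauchyKernel_le_one hδ1 _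
  set f : EuclideanSpace ℝ (Fin m) → ℝ≥0∞ := fun y =>
    ∑' k : Fin m → ℤ, ENNReal.ofReal (a k) * ENNReal.ofReal (∏ j, cauchyKernel δ (y j - k j))
    with hf
  have hmeas : ∀ k : Fin m → ℤ, Measurable fun y : EuclideanSpace ℝ (Fin m) =>
      ENNReal.ofReal (∏ j, cauchyKernel δ (y j - k j)) := fun k =>
    ENNReal.measurable_ofReal.comp (continuous_finsetProd _ fun j _ =>
      (continuous_cauchyKernel δ).comp (by fun_prop)).measurable
  have hfm : Measurable f := Measurable.tsum fun k => (hmeas k).const_mul _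
  have hSf : S ⊆ {y | ENNReal.ofReal A ≤ f y} := by
    intro y hy
    have hsum : Summable fun k => a k * ∏ j, cauchyKernel δ (y j - k j) :=
      Summable.of_nonneg_of_le (fun k => mul_nonneg (ha k) (hB0 k y))
        (fun k => mul_le_of_le_one_right (ha k) (hB1 k y)) hs
    have : f y = ENNReal.ofReal (∑' k, a k * ∏ j, cauchyKernel δ (y j - k j)) := by
      rw [ENNReal.ofReal_tsum_of_nonneg (fun k => mul_nonneg (ha k) (hB0 k y)) hsum]
      simp only [hf, ENNReal.ofReal_mul (ha _)]
    rw [mem_ofPred_eq, this]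
    exact ENNReal.ofReal_le_ofReal (hS y hy)
  have hker : ∀ k : Fin m → ℤ, ∫⁻ y : EuclideanSpace ℝ (Fin m),
      ENNReal.ofReal (∏ j, cauchyKernel δ (y j - k j)) = ENNReal.ofReal (Real.pi ^ m) := by
    intro k
    rw [← ofReal_integral_eq_lintegral_ofReal
      (integrable_prod_coord fun j => (integrable_cauchyKernel hδ).comp_sub_right (k j : ℝ))
      (Eventually.of_forall (hB0 k)),
      integral_prod_coord fun j s => cauchyKernel δ (s - k j)]
    simp [integral_sub_right_eq_self (cauchyKernel δ), integral_cauchyKernel hδ]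
  calc ENNReal.ofReal A * volume S ≤ ENNReal.ofReal A * volume {y | ENNReal.ofReal A ≤ f y} := by
        gcongr
    _ ≤ ∫⁻ y, f y := mul_meas_ge_le_lintegral hfm _
    _ = ∑' k, ENNReal.ofReal (a k) * ENNReal.ofReal (Real.pi ^ m) := by
        rw [hf, lintegral_tsum fun k => ((hmeas k).const_mul _).aemeasurable]
        refine tsum_congr fun k => ?_
        rw [lintegral_const_mul _ (hmeas k), hker]
    _ = _ := by
        rw [ENNReal.tsum_mul_right, ← ENNReal.ofReal_tsum_of_nonneg ha hs, mul_comm,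
          ENNReal.ofReal_mul (by positivity)]

/-- The constant in the pointwise lower bound for the smoothed Fourier coefficients. -/
noncomputable def smoothingConst (m : ℕ) (p : ℝ) : ℝ :=
  (1 / (4 * (2 * Real.pi * 16) ^ m)) *
    (1 / (4 * ((2 * Real.pi * 16) ^ m * (3 * Real.pi) ^ m))) ^ (p - 1)

lemma smoothingConst_pos (m : ℕ) (p : ℝ) : 0 < smoothingConst m p := by
  unfold smoothingConst
  have := Real.pi_pos
  positivity

lemma smoothingConst_mul_le {m : ℕ} {p δ S : ℝ} (hδ : 0 < δ)
    (h : ∀ τ, 0 < τ → δ ^ m / 2 ≤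
      (2 * Real.pi * 16) ^ m * (τ * (3 * Real.pi) ^ m + τ ^ (1 - p) * S)) :
    smoothingConst m p * (δ ^ m) ^ p ≤ S := by
  have hπ := Real.pi_pos
  set K := (2 * Real.pi * 16) ^ m with hK
  set L := (3 * Real.pi) ^ m with hL
  have hK0 : 0 < K := by positivity
  have hL0 : 0 < L := by positivity
  set D := δ ^ m with hD
  have hD0 : 0 < D := by positivity
  -- With `τ = qD` the `τ`-term equals `D / 4`, half of the lower bound `D / 2`, and is absorbed.
  set q := 1 / (4 * (K * L)) with hq
  have hq0 : 0 < q := by positivity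
  have h1 := h (q * D) (by positivity)
  have h2 : K * (q * D * L) = D / 4 := by rw [hq]; field_simp
  have h3 : D / 4 ≤ K * ((q * D) ^ (1 - p) * S) := by linarith
  have h4 : (q * D) ^ (p - 1) * (q * D) ^ (1 - p) = 1 := by
    rw [← Real.rpow_add (by positivity)]; simp
  have h5 : D ^ p = D ^ (p - 1) * D := by rw [← Real.rpow_add_one hD0.ne']; ring_nf
  have h6 : smoothingConst m p * D ^ p = (q * D) ^ (p - 1) * (D / 4) / K := by
    rw [smoothingConst, Real.mul_rpow hq0.le hD0.le, h5]
    simp only [← hK, ← hL, ← hq]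
    field_simp
  rw [h6, div_le_iff₀ hK0]
  calc (q * D) ^ (p - 1) * (D / 4) ≤ (q * D) ^ (p - 1) * (K * ((q * D) ^ (1 - p) * S)) := by
        gcongr
    _ = ((q * D) ^ (p - 1) * (q * D) ^ (1 - p)) * (S * K) := by ring
    _ = S * K := by rw [h4, one_mul]

open scoped Pointwise in
/-- If near every point of `W` the phase is within `1 / (2|l|)` of its tangent plane at scale `δ`,
then `‖F‖_{A_p}` is bounded below. -/
lemma ofReal_mul_volume_gradient_image_le {m : ℕ} {p δ l : ℝ} (hp : 1 ≤ p)
    {F : EuclideanSpace ℝ (Fin m) → ℂ} (hF : MemAp p F) (φ : EuclideanSpace ℝ (Fin m) → ℝ)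
    (hδ : 0 < δ) (hδ1 : δ ≤ 1) {W : Set (EuclideanSpace ℝ (Fin m))}
    (hcube : ∀ t₀ ∈ W, ∀ t : EuclideanSpace ℝ (Fin m), (∀ j, |t j - t₀ j| ≤ δ) → t ∈ cube m)
    (hFφ : ∀ t₀ ∈ W, ∀ t : EuclideanSpace ℝ (Fin m), (∀ j, |t j - t₀ j| ≤ δ) →
      F t = Complex.exp (Complex.I * l * φ t))
    (herr : ∀ t₀ ∈ W, ∀ t : EuclideanSpace ℝ (Fin m), (∀ j, |t j - t₀ j| ≤ δ) →
      |l * (φ t - φ t₀ - inner ℝ (gradient φ t₀) (t - t₀))| ≤ 1 / 2) :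
    ENNReal.ofReal (smoothingConst m p * (δ ^ m) ^ p * |l| ^ m) * volume (gradient φ '' W) ≤
      ENNReal.ofReal (Real.pi ^ m * normAp p F ^ p) := by
  have hS : ∀ y ∈ l • (gradient φ '' W), smoothingConst m p * (δ ^ m) ^ p ≤
      ∑' k : Fin m → ℤ, ‖torusCoeff F k‖ ^ p * ∏ j, cauchyKernel δ (y j - k j) := by
    rintro _ ⟨_, ⟨t₀, ht₀, rfl⟩, rfl⟩
    refine smoothingConst_mul_le hδ fun τ hτ => ?_
    have hmem : ∀ (j : Fin m) (s : ℝ), |s| ≤ δ → t₀ j + s ∈ Icc 0 (2 * Real.pi) := by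
      intro j s hs
      have := hcube t₀ ht₀ (t₀ + EuclideanSpace.single j s) (fun i => by
        by_cases hij : i = j
        · subst hij; simpa using hs
        · simpa [hij] using hδ.le) j
      simpa using this
    refine le_trans (le_norm_setIntegral_mul_bump hF.integrable φ t₀ (gradient φ t₀) hδ
      (fun t ht => hcube t₀ ht₀ t fun j => (ht j).le)
      (fun t ht => hFφ t₀ ht₀ t fun j => (ht j).le)
      (fun t ht => herr t₀ ht₀ t fun j => (ht j).le)) ?_
    refine norm_setIntegral_mul_bump_le hp hF.integrable hF.summable t₀
      (fun j => l * gradient φ t₀ j) hδ hδ1 hτ (fun j => ?_) (fun j => ?_)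
    · simpa [sub_eq_add_neg] using (hmem j (-δ) (by rw [abs_neg, abs_of_pos hδ])).1
    · exact (hmem j δ (by rw [abs_of_pos hδ])).2
  have h := ofReal_mul_volume_le_of_le_tsum hδ hδ1 (fun k => by positivity) hF.summable hS
  have hκ := smoothingConst_pos m p
  have hnorm : normAp p F ^ p = ∑' k : Fin m → ℤ, ‖torusCoeff F k‖ ^ p := by
    unfold normAp
    rw [← Real.rpow_mul (tsum_nonneg fun k => by positivity), one_div_mul_cancel (by linarith),
      Real.rpow_one]
  -- Dilating the gradient image by `l` produces the factor `|l|^m`.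
  rw [Measure.addHaar_smul, ← mul_assoc, ← ENNReal.ofReal_mul (by positivity)] at h
  simp only [finrank_euclideanSpace, Fintype.card_fin, abs_pow] at h
  rwa [hnorm]

/-! ### Consequences of the hypotheses on `ω`, `φ` and `V`. -/

lemma normAp_nonneg {m : ℕ} (p : ℝ) (F : EuclideanSpace ℝ (Fin m) → ℂ) : 0 ≤ normAp p F :=
  Real.rpow_nonneg (tsum_nonneg fun k => by positivity) _

lemma edist_gradient_le_of_memC1 {m : ℕ} {ω : ℝ → ℝ} {V : Set (EuclideanSpace ℝ (Fin m))}
    {φ : EuclideanSpace ℝ (Fin m) → ℝ} (hφ : MemC1 ω V φ) :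
    ∃ C > 0, ∃ δ₀ > 0, ∀ δ, 0 < δ → δ < δ₀ → ∀ t₁ ∈ V, ∀ t₂ ∈ V, dist t₁ t₂ ≤ δ →
      edist (gradient φ t₁) (gradient φ t₂) ≤ ENNReal.ofReal (C * |ω δ|) := by
  obtain ⟨-, C, hC⟩ := hφ
  obtain ⟨δ₀, hδ₀, h⟩ := mem_nhdsGT_iff_exists_Ioo_subset.1 hC
  refine ⟨|C| + 1, by positivity, δ₀, hδ₀, fun δ h1 h2 t₁ ht₁ t₂ ht₂ hd => ?_⟩
  have h3 : modulus V (gradient φ) δ ≤ ENNReal.ofReal (C * ω δ) := h ⟨h1, h2⟩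
  have h4 : edist (gradient φ t₁) (gradient φ t₂) ≤ modulus V (gradient φ) δ :=
    le_iSup₂_of_le t₁ ht₁ (le_iSup₂_of_le t₂ ht₂ (le_iSup_of_le hd le_rfl))
  refine h4.trans (h3.trans (ENNReal.ofReal_le_ofReal ?_))
  have := le_abs_self (C * ω δ)
  rw [abs_mul] at this
  nlinarith [abs_nonneg (ω δ)]

/-- If `ω` vanished at some positive point, it would vanish on `[0, δ]`; then `∇φ` would be locally
constant, hence constant on the connected set `V`, and its image a null set. -/
lemma omega_pos {m : ℕ} (hm : 1 ≤ m) {ω : ℝ → ℝ} (hωmono : MonotoneOn ω (Ici 0)) (hω0 : ω 0 = 0)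
    {V : Set (EuclideanSpace ℝ (Fin m))} (hVconn : IsConnected V)
    {φ : EuclideanSpace ℝ (Fin m) → ℝ} (hφ : MemC1 ω V φ)
    (hgrad : 0 < volume (gradient φ '' V)) {δ : ℝ} (hδ : 0 < δ) : 0 < ω δ := by
  by_contra hneg
  obtain ⟨C, -, δ₀, hδ₀, h⟩ := edist_gradient_le_of_memC1 hφ
  set η := min δ δ₀ / 2 with hη
  have hη0 : 0 < η := by positivity
  have hη1 : η < δ₀ := by have := min_le_right δ δ₀; linarith
  have hη2 : η ≤ δ := by have := min_le_left δ δ₀; linarith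
  have hωη : ω η = 0 := le_antisymm
    ((hωmono hη0.le hδ.le hη2).trans (not_lt.1 hneg))
    (hω0 ▸ hωmono (Set.mem_Ici.2 le_rfl) hη0.le hη0.le)
  have hloc : ∀ t₁ ∈ V, ∀ t₂ ∈ V, dist t₁ t₂ ≤ η → gradient φ t₁ = gradient φ t₂ := by
    intro t₁ h1 t₂ h2 hd
    have := h η hη0 hη1 t₁ h1 t₂ h2 hd
    rw [hωη] at this
    simpa using this
  have hconst : (gradient φ '' V).Subsingleton := by
    rintro _ ⟨t₁, h1, rfl⟩ _ ⟨t₂, h2, rfl⟩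
    have : PreconnectedSpace V := isPreconnected_iff_preconnectedSpace.1 hVconn.isPreconnected
    have hlc : IsLocallyConstant fun t : V => gradient φ t := by
      rw [IsLocallyConstant.iff_eventually_eq]
      intro t
      filter_upwards [Metric.ball_mem_nhds t hη0] with s hs
      exact hloc s s.2 t t.2 (le_of_lt hs)
    exact hlc.apply_eq_of_preconnectedSpace ⟨t₁, h1⟩ ⟨t₂, h2⟩
  have : Nonempty (Fin m) := ⟨⟨0, hm⟩⟩
  have : Nontrivial (EuclideanSpace ℝ (Fin m)) := inferInstance
  exact hgrad.ne' (hconst.measure_zero volume)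

lemma chi_strictMonoOn {ω : ℝ → ℝ} (hωmono : MonotoneOn ω (Ici 0))
    (hpos : ∀ δ, 0 < δ → 0 < ω δ) : StrictMonoOn (chi ω) (Ici 0) := by
  intro a ha b hb hab
  have hb0 : 0 < b := lt_of_le_of_lt ha hab
  calc a * ω a ≤ a * ω b := mul_le_mul_of_nonneg_left (hωmono ha hb hab.le) ha
    _ < b * ω b := mul_lt_mul_of_pos_right hab (hpos b hb0)

lemma chi_bijOn {ω : ℝ → ℝ} (hωcont : ContinuousOn ω (Ici 0)) (hωmono : MonotoneOn ω (Ici 0))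
    (hpos : ∀ δ, 0 < δ → 0 < ω δ) : BijOn (chi ω) (Ici 0) (Ici 0) := by
  have hmono := chi_strictMonoOn hωmono hpos
  have h0 : chi ω 0 = 0 := by simp [chi]
  refine ⟨fun a ha => ?_, hmono.injOn, fun b hb => ?_⟩
  · rw [mem_Ici, ← h0]
    exact hmono.monotoneOn (mem_Ici.2 le_rfl) ha ha
  · have hω1 := hpos 1 one_pos
    -- As `R ≥ 1`, monotonicity gives `χ(R) ≥ R ω(1) ≥ b`, which the intermediate value theorem
    -- needs.
    set R := max 1 (b / ω 1) with hR
    have hR0 : 0 ≤ R := zero_le_one.trans (le_max_left _ _)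
    have hRb : b ≤ chi ω R := by
      have h1 : b ≤ R * ω 1 := (div_le_iff₀ hω1).1 (le_max_right _ _)
      exact h1.trans (mul_le_mul_of_nonneg_left
        (hωmono (mem_Ici.2 zero_le_one) hR0 (le_max_left _ _)) hR0)
    have hc : ContinuousOn (chi ω) (Icc 0 R) :=
      continuousOn_id.mul (hωcont.mono Icc_subset_Ici_self)
    obtain ⟨x, hx, rfl⟩ := intermediate_value_Icc hR0 hc ⟨by rw [h0]; exact hb, hRb⟩
    exact ⟨x, hx.1, rfl⟩

/-- A differentiable function with gradient modulus `ω` deviates from its tangent plane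
by at most `C R ω(R)` at distance `R`. -/
lemma abs_sub_sub_inner_gradient_le {m : ℕ} {V : Set (EuclideanSpace ℝ (Fin m))} (hV : IsOpen V)
    {φ : EuclideanSpace ℝ (Fin m) → ℝ} (hφ : DifferentiableOn ℝ φ V)
    {t₀ : EuclideanSpace ℝ (Fin m)} {R B : ℝ} (hR : 0 ≤ R) (hB : 0 ≤ B)
    (hball : Metric.closedBall t₀ R ⊆ V)
    (hgrad : ∀ t ∈ Metric.closedBall t₀ R,
      edist (gradient φ t) (gradient φ t₀) ≤ ENNReal.ofReal B)
    {t : EuclideanSpace ℝ (Fin m)} (ht : t ∈ Metric.closedBall t₀ R) :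
    |φ t - φ t₀ - inner ℝ (gradient φ t₀) (t - t₀)| ≤ B * R := by
  have hd : ∀ s ∈ Metric.closedBall t₀ R, HasFDerivAt φ
      (InnerProductSpace.toDual ℝ _ (gradient φ s)) s := fun s hs =>
    ((hφ.differentiableAt (hV.mem_nhds (hball hs))).hasGradientAt).hasFDerivAt
  have h := Convex.norm_image_sub_le_of_norm_hasFDerivWithin_le' (C := B)
    (φ := InnerProductSpace.toDual ℝ _ (gradient φ t₀))
    (fun s hs => (hd s hs).hasFDerivWithinAt) (fun s hs => ?_) (convex_closedBall t₀ R)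
    (Metric.mem_closedBall_self hR) ht
  · rw [InnerProductSpace.toDual_apply_apply, Real.norm_eq_abs] at h
    refine h.trans (mul_le_mul_of_nonneg_left ?_ hB)
    rwa [← dist_eq_norm]
  · rw [← map_sub, LinearIsometryEquiv.norm_map, ← dist_eq_norm]
    have := hgrad s hs
    rw [edist_dist] at this
    exact (ENNReal.ofReal_le_ofReal_iff hB).1 this

/-- A quantitative interior of `V` already has gradient image of positive measure. -/
lemma exists_radius_volume_gradient_image_pos {m : ℕ} {V : Set (EuclideanSpace ℝ (Fin m))}
    (hV : IsOpen V) (g : EuclideanSpace ℝ (Fin m) → EuclideanSpace ℝ (Fin m))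
    (hg : 0 < volume (g '' V)) :
    ∃ r > 0, 0 < volume (g '' {t | Metric.closedBall t r ⊆ V}) := by
  by_contra! hcon
  -- The open set `V` is the countable union of these interiors, so their gradient images cannot all
  -- be null.
  refine hg.ne' (measure_mono_null (t := ⋃ n : ℕ,
    g '' {t | Metric.closedBall t (1 / ((n : ℝ) + 1)) ⊆ V}) ?_ ?_)
  · rintro _ ⟨t, ht, rfl⟩
    obtain ⟨ε, hε, hb⟩ := Metric.isOpen_iff.1 hV t ht
    obtain ⟨n, hn⟩ := exists_nat_one_div_lt hε
    exact mem_iUnion.2 ⟨n, t, (Metric.closedBall_subset_ball hn).trans hb, rfl⟩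
  · exact measure_iUnion_null fun n => le_antisymm (hcon _ (by positivity)) zero_le

lemma dist_le_of_forall_abs_le {m : ℕ} {δ : ℝ} (hδ : 0 ≤ δ)
    {s t : EuclideanSpace ℝ (Fin m)} (h : ∀ j, |t j - s j| ≤ δ) : dist t s ≤ m * δ := by
  rw [EuclideanSpace.dist_eq]
  refine Real.sqrt_le_iff.2 ⟨by positivity, ?_⟩
  have h1 : ∑ j, dist (t j) (s j) ^ 2 ≤ ∑ _j : Fin m, δ ^ 2 :=
    Finset.sum_le_sum fun j _ => pow_le_pow_left₀ dist_nonneg (h j) 2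
  refine h1.trans ?_
  simp only [Finset.sum_const, Finset.card_univ, Fintype.card_fin, nsmul_eq_mul, mul_pow]
  refine mul_le_mul_of_nonneg_right ?_ (sq_nonneg δ)
  exact_mod_cast Nat.le_self_pow two_ne_zero m

/-! ### Choice of scale and conclusion. -/

theorem theorem1 (m : ℕ) (hm : 1 ≤ m) (p : ℝ) (hp1 : 1 ≤ p) (hp2 : p < 2)
    (ω : ℝ → ℝ) (hωcont : ContinuousOn ω (Set.Ici 0)) (hωmono : MonotoneOn ω (Set.Ici 0))
    (hω0 : ω 0 = 0)
    (V : Set (EuclideanSpace ℝ (Fin m))) (hVopen : IsOpen V) (hVconn : IsConnected V)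
    (hVcube : V ⊆ cube m)
    (φ : EuclideanSpace ℝ (Fin m) → ℝ) (hφ : MemC1 ω V φ)
    (hgrad : 0 < volume (gradient φ '' V)) :
    Set.BijOn (chi ω) (Set.Ici 0) (Set.Ici 0) ∧
    ∃ c : ℝ, 0 < c ∧ ∀ l : ℝ, 1 ≤ |l| →
      MemApLocal p V (fun t => Complex.exp (Complex.I * (l : ℂ) * (φ t : ℂ))) →
      c * (|l| ^ (1 / p) * chiInv ω (1 / |l|)) ^ m ≤
        normApLocal p V (fun t => Complex.exp (Complex.I * (l : ℂ) * (φ t : ℂ))) := by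
  have hpos : ∀ δ, 0 < δ → 0 < ω δ := fun δ => omega_pos hm hωmono hω0 hVconn hφ hgrad
  have hbij := chi_bijOn hωcont hωmono hpos
  have hmono := chi_strictMonoOn hωmono hpos
  refine ⟨hbij, ?_⟩
  have hinv : ∀ y, 0 < y → 0 < chiInv ω y ∧ chi ω (chiInv ω y) = y := by
    intro y hy
    have h1 : chiInv ω y ∈ Ici (0 : ℝ) := hbij.surjOn.mapsTo_invFunOn hy.le
    have h2 : chi ω (chiInv ω y) = y := hbij.surjOn.rightInvOn_invFunOn hy.le
    refine ⟨lt_of_le_of_ne h1 fun h => ?_, h2⟩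
    rw [← h] at h2
    simp [chi] at h2
    exact hy.ne h2
  obtain ⟨r, hr, hv⟩ := exists_radius_volume_gradient_image_pos hVopen (gradient φ) hgrad
  obtain ⟨C, hC, δ₀, hδ₀, hmod⟩ := edist_gradient_le_of_memC1 hφ
  set W := {t | Metric.closedBall t r ⊆ V} with hW
  have hWV : W ⊆ V := fun t ht => ht (Metric.mem_closedBall_self hr.le)
  obtain ⟨w, hw, hwv⟩ : ∃ w : ℝ, 0 < w ∧ ENNReal.ofReal w ≤ volume (gradient φ '' W) := by
    obtain ⟨w, hw0, hw1⟩ := ENNReal.lt_iff_exists_nnreal_btwn.1 hv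
    exact ⟨w, by exact_mod_cast hw0, by simpa using hw1.le⟩
  set D := chiInv ω 1 with hD
  have hD0 : 0 < D := (hinv 1 one_pos).1
  -- Since `|l| ≥ 1`, `D` bounds every `χ⁻¹(1/|l|)`, so one `ε` serves all `l`: `C * ε ≤ 1 / 2`
  -- controls the phase error, and the bounds on `ε * D` keep the balls in `V`, the modulus estimate
  -- valid and the bump width at most `1`.
  obtain ⟨ε, hε, hε1, hεC, hεr, hεδ, hεD⟩ : ∃ ε : ℝ, 0 < ε ∧ ε ≤ 1 ∧ C * ε ≤ 1 / 2 ∧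
      ε * D ≤ r ∧ ε * D < δ₀ ∧ ε * D ≤ 1 := by
    set b := min (min r (δ₀ / 2)) 1 with hb
    have hb0 : 0 < b := by positivity
    set ε := min (min 1 (1 / (2 * C))) (b / D) with hε
    have h1 : ε ≤ 1 := (min_le_left _ _).trans (min_le_left _ _)
    have h2 : ε ≤ 1 / (2 * C) := (min_le_left _ _).trans (min_le_right _ _)
    have h3 : ε * D ≤ b := (le_div_iff₀ hD0).1 (min_le_right _ _)
    have h4 : b ≤ r := (min_le_left _ _).trans (min_le_left _ _)
    have h5 : b ≤ δ₀ / 2 := (min_le_left _ _).trans (min_le_right _ _)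
    have h6 : b ≤ 1 := min_le_right _ _
    refine ⟨ε, by positivity, h1, ?_, by linarith, by linarith, by linarith⟩
    rw [le_div_iff₀ (by positivity)] at h2
    linarith
  have hm0 : (0 : ℝ) < m := by exact_mod_cast hm
  have hm1 : (1 : ℝ) ≤ m := by exact_mod_cast hm
  have hp0 : 0 < p := by linarith
  have hκ := smoothingConst_pos m p
  have hπ := Real.pi_pos
  set q := smoothingConst m p * w / Real.pi ^ m with hq
  have hq0 : 0 < q := by positivity
  refine ⟨q ^ (1 / p) * (ε / m) ^ m, by positivity, fun l hl hloc => ?_⟩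
  have hl0 : 0 < |l| := by linarith
  refine le_csInf ?_ ?_
  · obtain ⟨F, hF, hFe⟩ := hloc
    exact ⟨_, F, hF, hFe, rfl⟩
  rintro _ ⟨F, hF, hFe, rfl⟩
  obtain ⟨hd0, hchi⟩ := hinv (1 / |l|) (by positivity)
  set d := chiInv ω (1 / |l|) with hd
  have hdD : d ≤ D := by
    refine (hmono.le_iff_le hd0.le hD0.le).1 ?_
    rw [hchi, (hinv 1 one_pos).2]
    exact div_le_one_of_le₀ hl hl0.le
  set R := ε * d with hR
  have hR0 : 0 < R := by positivity
  have hRD : R ≤ ε * D := mul_le_mul_of_nonneg_left hdD hε.le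
  have hRd : R ≤ d := mul_le_of_le_one_left hd0.le hε1
  -- A cube of half-side `R / m` lies in the ball of radius `R`.
  set δ := R / m with hδ
  have hδ0 : 0 < δ := by positivity
  have hδ1 : δ ≤ 1 := div_le_one_of_le₀ (by linarith) hm0.le
  have hball : ∀ t₀ ∈ W, Metric.closedBall t₀ R ⊆ V := fun t₀ ht₀ =>
    (Metric.closedBall_subset_closedBall (by linarith)).trans ht₀
  have hmem : ∀ t₀ t : EuclideanSpace ℝ (Fin m), (∀ j, |t j - t₀ j| ≤ δ) →
      t ∈ Metric.closedBall t₀ R := by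
    intro t₀ t ht
    have := dist_le_of_forall_abs_le hδ0.le ht
    rwa [hδ, mul_div_cancel₀ _ hm0.ne'] at this
  have hωR := hpos R hR0
  have herr : |l| * (C * |ω R| * R) ≤ 1 / 2 := by
    -- Only monotonicity of `ω` is used; the small factor `ε` comes from `R = ε * d`.
    have h1 : ω R * R ≤ ω d * R :=
      mul_le_mul_of_nonneg_right (hωmono hR0.le hd0.le hRd) hR0.le
    have h2 : |l| * (ω d * d) = 1 := by
      rw [chi, mul_comm] at hchi
      rw [hchi]; field_simp
    calc |l| * (C * |ω R| * R) = |l| * C * (ω R * R) := by rw [abs_of_pos hωR]; ring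
      _ ≤ |l| * C * (ω d * R) := by gcongr
      _ = C * ε * (|l| * (ω d * d)) := by rw [hR]; ring
      _ ≤ 1 / 2 := by rw [h2, mul_one]; exact hεC
  have hmain := ofReal_mul_volume_gradient_image_le (l := l) (W := W) hp1 hF φ hδ0 hδ1
    (fun t₀ ht₀ t ht => hVcube (hball t₀ ht₀ (hmem t₀ t ht)))
    (fun t₀ ht₀ t ht => hFe (hball t₀ ht₀ (hmem t₀ t ht)))
    (fun t₀ ht₀ t ht => by
      rw [abs_mul]
      refine le_trans (mul_le_mul_of_nonneg_left ?_ hl0.le) herr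
      refine abs_sub_sub_inner_gradient_le hVopen hφ.1 hR0.le (by positivity) (hball t₀ ht₀)
        (fun s hs => ?_) (hmem t₀ t ht)
      exact hmod R hR0 (by linarith) s (hball t₀ ht₀ hs) t₀ (hWV ht₀) hs)
  have hN0 := normAp_nonneg p F
  have hreal : smoothingConst m p * (δ ^ m) ^ p * |l| ^ m * w ≤ Real.pi ^ m * normAp p F ^ p := by
    refine (ENNReal.ofReal_le_ofReal_iff (by positivity)).1 (le_trans ?_ hmain)
    rw [ENNReal.ofReal_mul (by positivity)]
    gcongr
  -- Comparing `p`-th powers reduces the claim to `hreal`.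
  refine (Real.rpow_le_rpow_iff (by positivity) hN0 hp0).1 ?_
  have h1 : q ^ (1 / p) * (ε / m) ^ m * (|l| ^ (1 / p) * d) ^ m =
      q ^ (1 / p) * (δ ^ m * (|l| ^ m) ^ (1 / p)) := by
    rw [mul_pow, ← Real.rpow_natCast (|l| ^ (1 / p)), ← Real.rpow_mul hl0.le,
      ← Real.rpow_natCast |l|, ← Real.rpow_mul hl0.le, mul_comm (1 / p), hδ, hR]
    rw [mul_div_right_comm, mul_pow]
    ring
  have h2 : ∀ x : ℝ, 0 ≤ x → (x ^ (1 / p)) ^ p = x := fun x hx => by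
    rw [← Real.rpow_mul hx, one_div_mul_cancel hp0.ne', Real.rpow_one]
  rw [h1, Real.mul_rpow (by positivity) (by positivity), Real.mul_rpow (by positivity)
    (by positivity), h2 _ hq0.le, h2 _ (by positivity), hq, div_mul_eq_mul_div,
    div_le_iff₀ (by positivity)]
  linarith
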